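/- A weight function on $\mathbb{R}^n$ is a nonnegative, measurable, locally integrable function that vanishes only on a set of Lebesgue measure zero. For $1<p<\infty$, $\theta>0$ and a weight function $w$, let $L_w^{p),\theta}(\mathbb{R}^n)$ be the generalized grand Lebesgue space of (classes of a.e. equal) measurable functions $f:\mathbb{R}^n\to\mathbb{C}$ with $$\|f\|_{L_w^{p),\theta}}=\sup_{0<\varepsilon\le p-1}\varepsilon^{\theta}\Big(\int_{\mathbb{R}^n}|f(x)|^{p-\varepsilon}w(x)^{\varepsilon/p}\,dx\Big)^{1/(p-\varepsilon)}<\infty .$$ For $1<p,q<\infty$, $\theta_1,\theta_2>0$ and weight functions $a,b$ on $\mathbb{R}^n$, let $A_{q),\theta_2}^{p),\theta_1}(\mathbb{R}^n,a,b)$ be the space of all $f\in L_a^{p),\theta_1}(\mathbb{R}^n)$ that define a tempered distribution $\varphi\mapsto\int f\varphi$ (with absolutely convergent integrals, $\varphi$ Schwartz) and whose generalized Fourier transform $\hat f$ (defined by $\langle\hat f,\varphi\rangle=\langle f,\hat\varphi\rangle$, $\hat\varphi(x)=\int\varphi(\gamma)e^{-i\langle\gamma,x\rangle}d\gamma$)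 is a locally integrable function belonging to $L_b^{q),\theta_2}(\mathbb{R}^n)$, normed by $$\|f\|_{A_{q),\theta_2}^{p),\theta_1}}=\|f\|_{L_a^{p),\theta_1}}+\|\hat f\|_{L_b^{q),\theta_2}} .$$ The space $A_{q),\theta_2}^{p),\theta_1}(\mathbb{R}^n,a,b)$ is in general not reflexive: for every $n\ge 1$, all $1<p,q<\infty$ and all $\theta_1,\theta_2>0$ there exist weight functions $a,b$ on $\mathbb{R}^n$ such that $A_{q),\theta_2}^{p),\theta_1}(\mathbb{R}^n,a,b)$ is a Banach space that is not reflexive. -/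

import Mathlib

noncomputable section

namespace GrandFourier

open MeasureTheory Set
open scoped SchwartzMap ENNReal FourierTransform

/-- A weight function on `ℝⁿ`: nonnegative, measurable, locally integrable, and vanishing only
on a set of Lebesgue measure zero. -/
structure Weight (n : ℕ) where
  toFun : EuclideanSpace ℝ (Fin n) → ℝ
  nonneg : ∀ x, 0 ≤ toFun x
  measurable : Measurable toFun
  locallyIntegrable : LocallyIntegrable toFun volume
  zeroSet_null : volume {x | toFun x = 0} = 0

/-- The measure `w(x)^s dx` on `ℝⁿ`. -/
def Weight.powMeasure {n : ℕ} (w : Weight n) (s : ℝ) : Measure (EuclideanSpace ℝ (Fin n)) :=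
  volume.withDensity fun x => ENNReal.ofReal (w.toFun x ^ s)

/-- The norm of the generalized grand Lebesgue space with exponent `p`, parameter `θ` and
grandizer `w`, namely the supremum over `0 < ε ≤ p - 1` of
`ε^θ * (∫ |f(x)|^(p-ε) w(x)^(ε/p) dx)^(1/(p-ε))`, as a value in `[0, ∞]`. -/
def grandNorm {n : ℕ} (p θ : ℝ) (w : Weight n)
    (f : EuclideanSpace ℝ (Fin n) →ₘ[volume] ℂ) : ℝ≥0∞ :=
  ⨆ ε ∈ Ioc (0 : ℝ) (p - 1),
    ENNReal.ofReal (ε ^ θ) * eLpNorm f (ENNReal.ofReal (p - ε)) (w.powMeasure (ε / p))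

/-- The Fourier integral `∫ φ(γ) e^{-i⟨γ, x⟩} dγ`. -/
def fourierInt {n : ℕ} (φ : EuclideanSpace ℝ (Fin n) → ℂ) (x : EuclideanSpace ℝ (Fin n)) : ℂ :=
  ∫ γ, φ γ * Complex.exp (-(Complex.I * (inner ℝ γ x : ℝ)))

/-- `HasFourier f h`: the function `f` defines a tempered distribution through the (absolutely
convergent) integrals `⟨f, φ⟩ = ∫ f φ`, and its generalized Fourier transform, given by
`⟨f̂, φ⟩ = ⟨f, φ̂⟩`, is the locally integrable function `h`. -/
structure HasFourier {n : ℕ} (f h : EuclideanSpace ℝ (Fin n) →ₘ[volume] ℂ) : Prop where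
  tempered : ∀ φ : 𝓢(EuclideanSpace ℝ (Fin n), ℂ), Integrable (fun x => f x * φ x) volume
  locallyIntegrable : LocallyIntegrable h volume
  pairing : ∀ φ : 𝓢(EuclideanSpace ℝ (Fin n), ℂ), HasCompactSupport φ →
    ∫ x, h x * φ x = ∫ x, f x * fourierInt φ x

open Classical in
/-- The generalized Fourier transform of `f`, when it exists as a function (and `0` otherwise). -/
def fourierFun {n : ℕ} (f : EuclideanSpace ℝ (Fin n) →ₘ[volume] ℂ) :
    EuclideanSpace ℝ (Fin n) →ₘ[volume] ℂ :=
  if hf : ∃ h, HasFourier f h then hf.choose else 0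

/-! ### Facts needed to see that the space below is a normed space -/

section Facts

variable {n : ℕ}

lemma powMeasure_ac (w : Weight n) (s : ℝ) : w.powMeasure s ≪ volume :=
  withDensity_absolutelyContinuous _ _

lemma aesm (w : Weight n) (s : ℝ) (f : EuclideanSpace ℝ (Fin n) →ₘ[volume] ℂ) :
    AEStronglyMeasurable f (w.powMeasure s) :=
  f.aestronglyMeasurable.mono_ac (powMeasure_ac w s)

lemma grandNorm_zero (p θ : ℝ) (w : Weight n) : grandNorm p θ w 0 = 0 := by
  have key : ∀ ε : ℝ, eLpNorm (0 : EuclideanSpace ℝ (Fin n) →ₘ[volume] ℂ)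
      (ENNReal.ofReal (p - ε)) (w.powMeasure (ε / p)) = 0 := by
    intro ε
    rw [eLpNorm_congr_ae ((powMeasure_ac w _).ae_le AEEqFun.coeFn_zero)]
    exact eLpNorm_zero
  simp [grandNorm, key]

lemma grandNorm_add_le (p θ : ℝ) (w : Weight n) (f g : EuclideanSpace ℝ (Fin n) →ₘ[volume] ℂ) :
    grandNorm p θ w (f + g) ≤ grandNorm p θ w f + grandNorm p θ w g := by
  refine iSup₂_le fun ε hε => ?_
  have h1 : (1 : ℝ≥0∞) ≤ ENNReal.ofReal (p - ε) := by
    rw [ENNReal.one_le_ofReal]; linarith [hε.2]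
  rw [eLpNorm_congr_ae ((powMeasure_ac w _).ae_le (AEEqFun.coeFn_add f g))]
  refine (mul_le_mul_right (eLpNorm_add_le (aesm w _ f) (aesm w _ g) h1) _).trans ?_
  rw [mul_add]
  exact add_le_add (le_iSup₂_of_le ε hε le_rfl) (le_iSup₂_of_le ε hε le_rfl)

lemma grandNorm_smul (p θ : ℝ) (w : Weight n) (c : ℂ)
    (f : EuclideanSpace ℝ (Fin n) →ₘ[volume] ℂ) :
    grandNorm p θ w (c • f) = ‖c‖ₑ * grandNorm p θ w f := by
  unfold grandNorm
  simp_rw [ENNReal.mul_iSup]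
  refine iSup_congr fun ε => iSup_congr fun _ => ?_
  rw [eLpNorm_congr_ae ((powMeasure_ac w _).ae_le (AEEqFun.coeFn_smul c f)), eLpNorm_const_smul,
    mul_left_comm]

lemma eq_zero_of_grandNorm {p : ℝ} (hp : 1 < p) (θ : ℝ) (w : Weight n)
    {f : EuclideanSpace ℝ (Fin n) →ₘ[volume] ℂ} (hf : grandNorm p θ w f = 0) : f = 0 := by
  have hmem : p - 1 ∈ Ioc (0 : ℝ) (p - 1) := ⟨by linarith, le_rfl⟩
  have h0 := le_antisymm ((le_iSup₂_of_le (p - 1) hmem le_rfl).trans hf.le) (zero_le)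
  rw [mul_eq_zero] at h0
  have hpos : 0 < (p - 1) ^ θ := Real.rpow_pos_of_pos (by linarith) _
  have h1 := h0.resolve_left (by simpa using hpos)
  rw [eLpNorm_eq_zero_iff (aesm w _ f) (by simp)] at h1
  have hm : Measurable fun x => ENNReal.ofReal (w.toFun x ^ ((p - 1) / p)) :=
    (w.measurable.pow_const _).ennreal_ofReal
  rw [Weight.powMeasure, Filter.EventuallyEq, ae_withDensity_iff hm] at h1
  have hz : ∀ᵐ x ∂(volume : Measure (EuclideanSpace ℝ (Fin n))), w.toFun x ≠ 0 := by
    rw [ae_iff]; simpa using w.zeroSet_null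
  refine AEEqFun.ext ?_
  filter_upwards [h1, hz, AEEqFun.coeFn_zero (β := ℂ)
    (μ := (volume : Measure (EuclideanSpace ℝ (Fin n))))] with x hx hx0 hx1
  rw [hx1]
  refine hx ?_
  have : 0 < w.toFun x ^ ((p - 1) / p) :=
    Real.rpow_pos_of_pos (lt_of_le_of_ne (w.nonneg x) (Ne.symm hx0)) _
  simpa using this

/-- The Fourier integral of a Schwartz function is a Schwartz function. -/
lemma exists_schwartz_fourierInt (φ : 𝓢(EuclideanSpace ℝ (Fin n), ℂ)) :
    ∃ ψ : 𝓢(EuclideanSpace ℝ (Fin n), ℂ), ∀ x, ψ x = fourierInt φ x := by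
  have hpi : (2 * Real.pi)⁻¹ ≠ 0 := by positivity
  refine ⟨SchwartzMap.compCLMOfContinuousLinearEquiv ℂ
    (ContinuousLinearEquiv.smulLeft (R₁ := ℝ) (M₁ := EuclideanSpace ℝ (Fin n))
      (Units.mk0 _ hpi)) (𝓕 φ), fun x => ?_⟩
  rw [SchwartzMap.compCLMOfContinuousLinearEquiv_apply, Function.comp_apply,
    SchwartzMap.fourier_coe, Real.fourier_eq', fourierInt]
  refine integral_congr_ae (Filter.Eventually.of_forall fun γ => ?_)
  have h : -2 * Real.pi * inner ℝ γ ((2 * Real.pi)⁻¹ • x) = -inner ℝ γ x := by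
    rw [inner_smul_right]; field_simp
  change Complex.exp (((-2 * Real.pi * inner ℝ γ ((2 * Real.pi)⁻¹ • x) : ℝ) : ℂ) * Complex.I) • φ γ
    = _
  rw [h, smul_eq_mul, mul_comm]
  congr 2
  push_cast
  ring

lemma integrable_mul_fourierInt {f : EuclideanSpace ℝ (Fin n) →ₘ[volume] ℂ}
    (hf : ∀ φ : 𝓢(EuclideanSpace ℝ (Fin n), ℂ), Integrable (fun x => f x * φ x) volume)
    (φ : 𝓢(EuclideanSpace ℝ (Fin n), ℂ)) :
    Integrable (fun x => f x * fourierInt φ x) volume := by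
  obtain ⟨ψ, hψ⟩ := exists_schwartz_fourierInt φ
  simpa [hψ] using hf ψ

lemma integrable_mul_compact {h : EuclideanSpace ℝ (Fin n) →ₘ[volume] ℂ}
    (hh : LocallyIntegrable h volume) {φ : 𝓢(EuclideanSpace ℝ (Fin n), ℂ)}
    (hφ : HasCompactSupport φ) : Integrable (fun x => h x * φ x) volume := by
  simpa [mul_comm] using hh.integrable_smul_left_of_hasCompactSupport φ.continuous hφ

lemma HasFourier.unique {f h k : EuclideanSpace ℝ (Fin n) →ₘ[volume] ℂ}
    (hh : HasFourier f h) (hk : HasFourier f k) : h = k := by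
  refine AEEqFun.ext (ae_eq_of_integral_contDiff_smul_eq hh.locallyIntegrable
    hk.locallyIntegrable fun g hg hgc => ?_)
  have hc : HasCompactSupport fun x => ((g x : ℝ) : ℂ) := hgc.comp_left Complex.ofReal_zero
  let φ := hc.toSchwartzMap (Complex.ofRealCLM.contDiff.comp hg)
  have e := (hh.pairing φ hc).trans (hk.pairing φ hc).symm
  have hφ : ∀ x, φ x = ((g x : ℝ) : ℂ) := fun _ => rfl
  simpa [hφ, mul_comm] using e

lemma HasFourier.add {f g h k : EuclideanSpace ℝ (Fin n) →ₘ[volume] ℂ}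
    (hf : HasFourier f h) (hg : HasFourier g k) : HasFourier (f + g) (h + k) where
  tempered φ := by
    refine ((hf.tempered φ).add (hg.tempered φ)).congr ?_
    filter_upwards [AEEqFun.coeFn_add f g] with x hx
    simp [hx, add_mul]
  locallyIntegrable := (hf.locallyIntegrable.add hg.locallyIntegrable).congr
    (AEEqFun.coeFn_add h k).symm
  pairing φ hφ := by
    have e1 : ∫ x, (h + k) x * φ x = ∫ x, (h x * φ x + k x * φ x) := by
      refine integral_congr_ae ?_
      filter_upwards [AEEqFun.coeFn_add h k] with x hx
      simp [hx, add_mul]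
    have e2 : ∫ x, (f + g) x * fourierInt φ x
        = ∫ x, (f x * fourierInt φ x + g x * fourierInt φ x) := by
      refine integral_congr_ae ?_
      filter_upwards [AEEqFun.coeFn_add f g] with x hx
      simp [hx, add_mul]
    rw [e1, e2, integral_add (integrable_mul_compact hf.locallyIntegrable hφ)
      (integrable_mul_compact hg.locallyIntegrable hφ),
      integral_add (integrable_mul_fourierInt hf.tempered φ)
      (integrable_mul_fourierInt hg.tempered φ), hf.pairing φ hφ, hg.pairing φ hφ]

lemma HasFourier.smul (c : ℂ) {f h : EuclideanSpace ℝ (Fin n) →ₘ[volume] ℂ}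
    (hf : HasFourier f h) : HasFourier (c • f) (c • h) where
  tempered φ := by
    refine ((hf.tempered φ).const_mul c).congr ?_
    filter_upwards [AEEqFun.coeFn_smul c f] with x hx
    simp [hx, mul_assoc]
  locallyIntegrable := (hf.locallyIntegrable.smul c).congr (AEEqFun.coeFn_smul c h).symm
  pairing φ hφ := by
    have e1 : ∫ x, (c • h) x * φ x = ∫ x, c * (h x * φ x) := by
      refine integral_congr_ae ?_
      filter_upwards [AEEqFun.coeFn_smul c h] with x hx
      simp [hx, mul_assoc]
    have e2 : ∫ x, (c • f) x * fourierInt φ x = ∫ x, c * (f x * fourierInt φ x) := by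
      refine integral_congr_ae ?_
      filter_upwards [AEEqFun.coeFn_smul c f] with x hx
      simp [hx, mul_assoc]
    rw [e1, e2, integral_const_mul, integral_const_mul, hf.pairing φ hφ]

lemma HasFourier.zero : HasFourier (0 : EuclideanSpace ℝ (Fin n) →ₘ[volume] ℂ) 0 where
  tempered φ := by
    refine (integrable_zero _ ℂ volume).congr ?_
    filter_upwards [AEEqFun.coeFn_zero (β := ℂ)
      (μ := (volume : Measure (EuclideanSpace ℝ (Fin n))))] with x hx
    simp [hx]
  locallyIntegrable := locallyIntegrable_zero.congr AEEqFun.coeFn_zero.symm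
  pairing φ hφ := by
    refine integral_congr_ae ?_
    filter_upwards [AEEqFun.coeFn_zero (β := ℂ)
      (μ := (volume : Measure (EuclideanSpace ℝ (Fin n))))] with x hx
    simp [hx]

lemma HasFourier.fourierFun_eq {f h : EuclideanSpace ℝ (Fin n) →ₘ[volume] ℂ}
    (hf : HasFourier f h) : fourierFun f = h := by
  have hex : ∃ h, HasFourier f h := ⟨h, hf⟩
  rw [fourierFun, dif_pos hex]
  exact hex.choose_spec.unique hf

end Facts

/-- The functions `f` (up to equality almost everywhere) in the generalized grand Lebesgue space
with data `p, θ₁, a` whose generalized Fourier transform exists as a function and belongs to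
the one with data `q, θ₂, b`. -/
def grandFourierSubmodule (n : ℕ) (p q θ₁ θ₂ : ℝ) (a b : Weight n) :
    Submodule ℂ (EuclideanSpace ℝ (Fin n) →ₘ[volume] ℂ) where
  carrier := {f | grandNorm p θ₁ a f < ⊤ ∧ ∃ h, HasFourier f h ∧ grandNorm q θ₂ b h < ⊤}
  add_mem' := by
    rintro f g ⟨hf, h, hfh, hh⟩ ⟨hg, k, hgk, hk⟩
    exact ⟨(grandNorm_add_le p θ₁ a f g).trans_lt (ENNReal.add_lt_top.2 ⟨hf, hg⟩), h + k,
      hfh.add hgk, (grandNorm_add_le q θ₂ b h k).trans_lt (ENNReal.add_lt_top.2 ⟨hh, hk⟩)⟩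
  zero_mem' := ⟨by simp [grandNorm_zero], 0, HasFourier.zero, by simp [grandNorm_zero]⟩
  smul_mem' := by
    rintro c f ⟨hf, h, hfh, hh⟩
    refine ⟨?_, c • h, hfh.smul c, ?_⟩
    · rw [grandNorm_smul]; exact ENNReal.mul_lt_top enorm_lt_top hf
    · rw [grandNorm_smul]; exact ENNReal.mul_lt_top enorm_lt_top hh

/-- The space `A_{q),θ₂}^{p),θ₁}(ℝⁿ, a, b)`. -/
def GrandFourierSpace (n : ℕ) (p q θ₁ θ₂ : ℝ) (a b : Weight n) : Type :=
  grandFourierSubmodule n p q θ₁ θ₂ a b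

namespace GrandFourierSpace

variable {n : ℕ} {p q θ₁ θ₂ : ℝ} {a b : Weight n}

instance : AddCommGroup (GrandFourierSpace n p q θ₁ θ₂ a b) :=
  inferInstanceAs (AddCommGroup (grandFourierSubmodule n p q θ₁ θ₂ a b))

instance : Module ℂ (GrandFourierSpace n p q θ₁ θ₂ a b) :=
  inferInstanceAs (Module ℂ (grandFourierSubmodule n p q θ₁ θ₂ a b))

/-- The norm `‖f‖ + ‖f̂‖`, each summand being a generalized grand Lebesgue norm. -/
instance : Norm (GrandFourierSpace n p q θ₁ θ₂ a b) where
  norm f := (grandNorm p θ₁ a f.1).toReal + (grandNorm q θ₂ b (fourierFun f.1)).toReal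

lemma norm_def (f : GrandFourierSpace n p q θ₁ θ₂ a b) :
    ‖f‖ = (grandNorm p θ₁ a f.1).toReal + (grandNorm q θ₂ b (fourierFun f.1)).toReal := rfl

lemma core [hp : Fact (1 < p)] :
    NormedSpace.Core ℂ (GrandFourierSpace n p q θ₁ θ₂ a b) where
  norm_nonneg f := by rw [norm_def]; positivity
  norm_smul c f := by
    obtain ⟨hf, h, hfh, hh⟩ := f.2
    have e : (c • f).1 = c • f.1 := rfl
    rw [norm_def, norm_def, e, (hfh.smul c).fourierFun_eq, hfh.fourierFun_eq, grandNorm_smul,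
      grandNorm_smul, ENNReal.toReal_mul, ENNReal.toReal_mul, toReal_enorm]
    ring
  norm_triangle f g := by
    obtain ⟨hf, h, hfh, hh⟩ := f.2
    obtain ⟨hg, k, hgk, hk⟩ := g.2
    have e : (f + g).1 = f.1 + g.1 := rfl
    rw [norm_def, norm_def, norm_def, e, (hfh.add hgk).fourierFun_eq, hfh.fourierFun_eq,
      hgk.fourierFun_eq]
    have h1 := ENNReal.toReal_mono (ENNReal.add_lt_top.2 ⟨hf, hg⟩).ne
      (grandNorm_add_le p θ₁ a f.1 g.1)
    have h2 := ENNReal.toReal_mono (ENNReal.add_lt_top.2 ⟨hh, hk⟩).ne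
      (grandNorm_add_le q θ₂ b h k)
    rw [ENNReal.toReal_add hf.ne hg.ne] at h1
    rw [ENNReal.toReal_add hh.ne hk.ne] at h2
    linarith
  norm_eq_zero_iff f := by
    constructor
    · intro h0
      rw [norm_def] at h0
      have h1 : (grandNorm p θ₁ a f.1).toReal = 0 :=
        le_antisymm (by linarith [ENNReal.toReal_nonneg (a := grandNorm q θ₂ b (fourierFun f.1))])
          ENNReal.toReal_nonneg
      rw [ENNReal.toReal_eq_zero_iff] at h1
      exact Subtype.ext (eq_zero_of_grandNorm hp.out θ₁ a (h1.resolve_right f.2.1.ne))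
    · rintro rfl
      have e : (0 : GrandFourierSpace n p q θ₁ θ₂ a b).1 = 0 := rfl
      rw [norm_def, e, HasFourier.zero.fourierFun_eq, grandNorm_zero, grandNorm_zero]
      simp

instance [Fact (1 < p)] : NormedAddCommGroup (GrandFourierSpace n p q θ₁ θ₂ a b) :=
  NormedAddCommGroup.ofCore core

instance [Fact (1 < p)] : NormedSpace ℂ (GrandFourierSpace n p q θ₁ θ₂ a b) :=
  NormedSpace.ofCore core

end GrandFourierSpace

/-- A normed space is reflexive if its canonical embedding into its bidual is onto. -/
def IsReflexive (X : Type*) [NormedAddCommGroup X] [NormedSpace ℂ X] : Prop :=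
  Function.Surjective (NormedSpace.inclusionInDoubleDual ℂ X)

end GrandFourier

end

/-! Take `a = 1` and let `b` decay so fast that every bounded function lies in the grand Lebesgue
space of `b`. At `ε = p - 1` the first norm dominates a multiple of the L¹ norm, so `f̂` is bounded
and the second summand is controlled by the first. The space is then the unweighted grand Lebesgue
space with an equivalent norm. Completeness follows from a.e. convergence and Fatou's lemma
(`completeSpace_of_containsBounded`).

Non-reflexivity comes from James' double limit criterion (`not_isReflexive_of_biorthogonal`). With
`l = 2 ^ j`, put a block of height `l ^ θ₁ * exp (p * l)` on a set of volume `exp (-(p ^ 2 * l))`,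
all sets disjoint. The contribution of a block to the norm at `ε` is at most `(ε * l) ^ θ₁ * exp
(-(ε * l))`: it concentrates at the scale `ε ~ 1 / l`. Distinct blocks thus live at distinct scales,
so their partial sums stay bounded (`exists_sum_rpow_mul_exp_neg_le`), while Hölder's inequality at
`ε = (p - 1) / l` bounds the normalized integrals over the sets (`block_inv_mul_le`). These
integrals take the values 1 and 0 on the partial sums in the triangular pattern that the criterion
requires. -/

namespace GrandFourier

open MeasureTheory Set Filter Topology
open scoped SchwartzMap ENNReal FourierTransform

/-! ### Weak-* limits and the double limit criterion -/

/-- A bounded sequence in a dual space has a weak-* limit along any ultrafilter. -/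
lemma exists_dual_tendsto {E : Type*} [NormedAddCommGroup E] [NormedSpace ℂ E]
    (φ : ℕ → StrongDual ℂ E) {C : ℝ} (hφ : ∀ k, ‖φ k‖ ≤ C) (U : Ultrafilter ℕ) :
    ∃ Φ : StrongDual ℂ E, ∀ x, Tendsto (fun k => φ k x) U (𝓝 (Φ x)) := by
  have hc := WeakDual.isCompact_closedBall (𝕜 := ℂ) (0 : StrongDual ℂ E) C
  obtain ⟨Φ, -, hΦ⟩ := hc.ultrafilter_le_nhds (U.map fun k => StrongDual.toWeakDual (φ k)) (by
    refine tendsto_principal.2 (Eventually.of_forall fun k => ?_)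
    simpa using hφ k)
  refine ⟨WeakDual.toStrongDual Φ, fun x => ?_⟩
  have : Tendsto (fun k => StrongDual.toWeakDual (φ k)) U (𝓝 Φ) := hΦ
  exact ((WeakDual.eval_continuous x).tendsto Φ).comp this

/-- James' double limit criterion: a normed space with a bounded sequence `S` and a bounded
sequence of functionals `ℓ` such that `ℓ j (S k)` is `1` for `j ≤ k` and `0` otherwise is not
reflexive. -/
lemma not_isReflexive_of_biorthogonal {X : Type*} [NormedAddCommGroup X] [NormedSpace ℂ X]
    (S : ℕ → X) (ℓ : ℕ → StrongDual ℂ X) {C M : ℝ} (hS : ∀ k, ‖S k‖ ≤ C) (hℓ : ∀ j, ‖ℓ j‖ ≤ M)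
    (h1 : ∀ j k, j ≤ k → ℓ j (S k) = 1) (h0 : ∀ j k, k < j → ℓ j (S k) = 0) :
    ¬ IsReflexive X := by
  intro hX
  let U : Ultrafilter ℕ := hyperfilter ℕ
  -- The ultrafilter is non-principal, so relations valid for all large indices pass to its limits.
  have hU : (U : Filter ℕ) ≤ atTop := Nat.hyperfilter_le_atTop
  obtain ⟨Φ, hΦ⟩ := exists_dual_tendsto (fun k => NormedSpace.inclusionInDoubleDual ℂ X (S k))
    (C := C) (fun k => (NormedSpace.double_dual_bound ℂ X (S k)).trans (hS k)) U
  obtain ⟨Ψ, hΨ⟩ := exists_dual_tendsto ℓ hℓ U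
  obtain ⟨x, rfl⟩ := hX Φ
  simp only [NormedSpace.dual_def] at hΦ
  have e1 : ∀ j, ℓ j x = 1 := fun j => tendsto_nhds_unique (hΦ (ℓ j))
    (tendsto_const_nhds.congr' (((eventually_ge_atTop j).filter_mono hU).mono
      fun k hk => (h1 j k hk).symm))
  have e2 : ∀ k, Ψ (S k) = 0 := fun k => tendsto_nhds_unique (hΨ (S k))
    (tendsto_const_nhds.congr' (((eventually_gt_atTop k).filter_mono hU).mono
      fun j hj => (h0 j k hj).symm))
  -- The two iterated limits of `ℓ j (S k)` both compute `Ψ x`, but they are 1 and 0.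
  have e3 : Ψ x = 1 := tendsto_nhds_unique (hΨ x)
    (tendsto_const_nhds.congr fun j => (e1 j).symm)
  have e4 : Ψ x = 0 := tendsto_nhds_unique (hΦ Ψ)
    (tendsto_const_nhds.congr fun k => (e2 k).symm)
  exact one_ne_zero (e3.symm.trans e4)


/-! ### Fourier transforms of integrable functions -/

section Fourier

variable {n : ℕ}

lemma continuous_scaled_inner :
    Continuous fun x : EuclideanSpace ℝ (Fin n) × EuclideanSpace ℝ (Fin n) =>
      ((2 * Real.pi)⁻¹ • innerₗ (EuclideanSpace ℝ (Fin n))) x.1 x.2 := by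
  simp only [LinearMap.smul_apply, innerₗ_apply_apply, smul_eq_mul]
  fun_prop

/-- Scaling the inner product by `(2π)⁻¹` absorbs the `2π` in the standard character, so the general
theory of Fourier integrals applies to this normalization. -/
lemma fourierInt_eq_vectorFourier (f : EuclideanSpace ℝ (Fin n) → ℂ) :
    fourierInt f = VectorFourier.fourierIntegral Real.fourierChar volume
      ((2 * Real.pi)⁻¹ • innerₗ (EuclideanSpace ℝ (Fin n))) f := by
  ext x
  rw [fourierInt, VectorFourier.fourierIntegral]
  refine integral_congr_ae (Eventually.of_forall fun γ => ?_)
  have hpi : (Real.pi : ℂ) ≠ 0 := by exact_mod_cast Real.pi_ne_zero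
  simp only [Circle.smul_def, Real.fourierChar_apply, LinearMap.smul_apply, innerₗ_apply_apply,
    smul_eq_mul]
  rw [mul_comm]
  congr 2
  push_cast
  field_simp

lemma continuous_fourierInt {f : EuclideanSpace ℝ (Fin n) → ℂ} (hf : Integrable f) :
    Continuous (fourierInt f) := by
  rw [fourierInt_eq_vectorFourier]
  exact VectorFourier.fourierIntegral_continuous Real.continuous_fourierChar
    continuous_scaled_inner hf

lemma norm_fourierInt_le (f : EuclideanSpace ℝ (Fin n) → ℂ) (x : EuclideanSpace ℝ (Fin n)) :
    ‖fourierInt f x‖ ≤ ∫ γ, ‖f γ‖ := by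
  rw [fourierInt_eq_vectorFourier]
  exact VectorFourier.norm_fourierIntegral_le_integral_norm _ _ _ _ _

lemma integral_fourierInt_mul {f g : EuclideanSpace ℝ (Fin n) → ℂ} (hf : Integrable f)
    (hg : Integrable g) : ∫ x, fourierInt f x * g x = ∫ x, f x * fourierInt g x := by
  have hflip : ((2 * Real.pi)⁻¹ • innerₗ (EuclideanSpace ℝ (Fin n))).flip =
      (2 * Real.pi)⁻¹ • innerₗ (EuclideanSpace ℝ (Fin n)) := by
    ext x y
    simp [real_inner_comm]
  have := VectorFourier.integral_fourierIntegral_smul_eq_flip (μ := volume) (ν := volume)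
    Real.continuous_fourierChar continuous_scaled_inner hf hg
  rw [hflip] at this
  simpa only [fourierInt_eq_vectorFourier, smul_eq_mul] using this

/-- The generalized Fourier transform of an integrable function is its Fourier integral. -/
lemma hasFourier_of_integrable {f : EuclideanSpace ℝ (Fin n) →ₘ[volume] ℂ} (hf : Integrable f) :
    HasFourier f (AEEqFun.mk (fourierInt f) (continuous_fourierInt hf).aestronglyMeasurable) where
  tempered φ := by
    obtain ⟨C, hC⟩ := φ.toBoundedContinuousFunction.isBounded_range.exists_norm_le
    refine hf.mul_bdd (c := C) φ.continuous.aestronglyMeasurable (Eventually.of_forall fun x => ?_)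
    exact hC _ ⟨x, rfl⟩
  locallyIntegrable := (continuous_fourierInt hf).locallyIntegrable.congr
    (AEEqFun.coeFn_mk _ _).symm
  pairing φ _ := by
    -- The pairing identity is the multiplication formula, that is, Fubini's theorem.
    rw [← integral_fourierInt_mul hf φ.integrable]
    refine integral_congr_ae ?_
    filter_upwards [AEEqFun.coeFn_mk (fourierInt f)
      (continuous_fourierInt hf).aestronglyMeasurable] with x hx
    rw [hx]

lemma ae_norm_fourierFun_le {f : EuclideanSpace ℝ (Fin n) →ₘ[volume] ℂ} (hf : Integrable f) :
    ∀ᵐ x, ‖fourierFun f x‖ ≤ ∫ γ, ‖f γ‖ := by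
  rw [(hasFourier_of_integrable hf).fourierFun_eq]
  filter_upwards [AEEqFun.coeFn_mk (fourierInt f)
    (continuous_fourierInt hf).aestronglyMeasurable] with x hx
  rw [hx]
  exact norm_fourierInt_le f x

end Fourier

/-! ### The weights, and bounded functions in the target space -/

section Weights

variable {n : ℕ}

/-- Equivalent to `t ^ s ≤ exp t`; the bound `s ≤ 1` gives constant 1. It trades exponential decay
for a small negative power of `ε`. -/
lemma exp_neg_le_rpow_neg {s t : ℝ} (hs : 0 < s) (hs1 : s ≤ 1) (ht : 0 < t) :
    Real.exp (-t) ≤ t ^ (-s) := by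
  rw [Real.exp_neg, Real.rpow_neg ht.le]
  refine inv_anti₀ (Real.rpow_pos_of_pos ht s) ?_
  rcases le_total t 1 with h | h
  · exact (Real.rpow_le_one ht.le h hs.le).trans (Real.one_le_exp ht.le)
  · calc t ^ s ≤ t ^ (1 : ℝ) := Real.rpow_le_rpow_of_exponent_le h hs1
      _ = t := Real.rpow_one t
      _ ≤ Real.exp t := by linarith [Real.add_one_le_exp t]

/-- The weight `exp (-(1 + |x|)^m)`. -/
noncomputable def decayWeight (n : ℕ) (m : ℝ) : Weight n where
  toFun x := Real.exp (-(1 + ‖x‖) ^ m)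
  nonneg x := (Real.exp_pos _).le
  measurable := by fun_prop
  locallyIntegrable := by
    refine Continuous.locallyIntegrable (Real.continuous_exp.comp (Continuous.neg ?_))
    exact (continuous_const.add continuous_norm).rpow_const fun x => Or.inl
      (by positivity : (0 : ℝ) < 1 + ‖x‖).ne'
  zeroSet_null := by simp [Real.exp_ne_zero]

/-- The constant weight `1`. -/
noncomputable def oneWeight (n : ℕ) : Weight n where
  toFun _ := 1
  nonneg _ := zero_le_one
  measurable := measurable_const
  locallyIntegrable := locallyIntegrable_const 1
  zeroSet_null := by simp

@[simp] lemma oneWeight_powMeasure (s : ℝ) : (oneWeight n).powMeasure s = volume := by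
  simp [Weight.powMeasure, oneWeight]

/-- Bounded functions belong to the grand Lebesgue space with weight `b`, continuously with
constant `K`. -/
def ContainsBounded (q θ : ℝ) (b : Weight n) (K : ℝ) : Prop :=
  0 ≤ K ∧ ∀ (h : EuclideanSpace ℝ (Fin n) →ₘ[volume] ℂ) (C : ℝ),
    (∀ᵐ x, ‖h x‖ ≤ C) → grandNorm q θ b h ≤ ENNReal.ofReal (K * C)

/-- A sufficiently fast decaying weight makes every bounded function belong to the grand
Lebesgue space. -/
lemma exists_containsBounded (n : ℕ) {q θ : ℝ} (hq : 1 < q) (hθ : 0 < θ) :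
    ∃ b : Weight n, ∃ K : ℝ, ContainsBounded q θ b K := by
  -- The total mass of `b ^ (ε / q)` will grow like `ε ^ (-s)`: the factor `ε ^ θ` absorbs this when
  -- `s ≤ θ`, and `s ≤ 1` is needed for `exp_neg_le_rpow_neg`.
  set s : ℝ := min θ 1 with hs_def
  have hs : 0 < s := lt_min hθ one_pos
  have hs1 : s ≤ 1 := min_le_right _ _
  have hsθ : s ≤ θ := min_le_left _ _
  have hint : Integrable fun x : EuclideanSpace ℝ (Fin n) => (1 + ‖x‖) ^ (-((n : ℝ) + 1)) :=
    integrable_one_add_norm (by simp)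
  set I : ℝ := ∫ x : EuclideanSpace ℝ (Fin n), (1 + ‖x‖) ^ (-((n : ℝ) + 1)) with hI
  have hI0 : 0 ≤ I := integral_nonneg fun x => by positivity
  -- The exponent `(n + 1) / s` turns into `-(n + 1)` after raising to the power `-s`, which is
  -- integrable on ℝⁿ.
  refine ⟨decayWeight n ((n + 1) / s), (1 + I) * q ^ θ, by positivity, fun h C hC => ?_⟩
  refine iSup₂_le fun ε hε => ?_
  have hε0 : 0 < ε := hε.1
  have hεq : ε / q ≤ 1 := (div_le_one (by linarith)).2 (by linarith [hε.2])
  have ht0 : 0 < ε / q := by positivity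
  have hmass : (decayWeight n ((n + 1) / s)).powMeasure (ε / q) univ ≤
      ENNReal.ofReal ((1 + I) * (ε / q) ^ (-s)) := by
    rw [Weight.powMeasure, withDensity_apply _ MeasurableSet.univ, Measure.restrict_univ]
    calc ∫⁻ x : EuclideanSpace ℝ (Fin n),
          ENNReal.ofReal ((decayWeight n ((n + 1) / s)).toFun x ^ (ε / q))
        ≤ ∫⁻ x : EuclideanSpace ℝ (Fin n),
          ENNReal.ofReal ((ε / q) ^ (-s) * (1 + ‖x‖) ^ (-((n : ℝ) + 1))) := by
          refine lintegral_mono fun x => ENNReal.ofReal_le_ofReal ?_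
          have hx : 0 < 1 + ‖x‖ := by positivity
          change Real.exp (-(1 + ‖x‖) ^ (((n : ℝ) + 1) / s)) ^ (ε / q) ≤ _
          rw [← Real.exp_mul, neg_mul, mul_comm]
          refine (exp_neg_le_rpow_neg hs hs1 (by positivity)).trans_eq ?_
          rw [Real.mul_rpow ht0.le (by positivity), ← Real.rpow_mul hx.le]
          congr 2
          field_simp
      _ = ENNReal.ofReal ((ε / q) ^ (-s) * I) := by
          rw [← ofReal_integral_eq_lintegral_ofReal (hint.const_mul _)
            (Eventually.of_forall fun x => by positivity), integral_const_mul]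
      _ ≤ _ := by
          refine ENNReal.ofReal_le_ofReal ?_
          have : 0 < (ε / q) ^ (-s) := by positivity
          nlinarith
  -- Using `1 + I` in place of `I` keeps the mass bound at least 1, so taking the root of order `q -
  -- ε ≥ 1` can only decrease it.
  have hone : 1 ≤ (1 + I) * (ε / q) ^ (-s) := by
    have : 1 ≤ (ε / q) ^ (-s) := Real.one_le_rpow_of_pos_of_le_one_of_nonpos ht0 hεq (by linarith)
    nlinarith
  have hqε : 1 ≤ q - ε := by linarith [hε.2]
  have hroot : (decayWeight n ((n + 1) / s)).powMeasure (ε / q) univ ^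
      (ENNReal.ofReal (q - ε)).toReal⁻¹ ≤ ENNReal.ofReal ((1 + I) * (ε / q) ^ (-s)) := by
    rw [ENNReal.toReal_ofReal (by linarith)]
    refine (ENNReal.rpow_le_rpow hmass (by positivity)).trans ?_
    rw [ENNReal.ofReal_rpow_of_nonneg (by linarith) (by positivity)]
    exact ENNReal.ofReal_le_ofReal ((Real.rpow_le_rpow_of_exponent_le hone
      (inv_le_one_of_one_le₀ hqε)).trans_eq (Real.rpow_one _))
  calc ENNReal.ofReal (ε ^ θ) * eLpNorm h (ENNReal.ofReal (q - ε)) _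
      ≤ ENNReal.ofReal (ε ^ θ) * (ENNReal.ofReal ((1 + I) * (ε / q) ^ (-s)) * ENNReal.ofReal C) := by
        gcongr
        exact (eLpNorm_le_of_ae_bound ((powMeasure_ac _ _).ae_le hC)).trans (by gcongr)
    _ ≤ _ := by
        have hC0 : 0 ≤ C := by
          obtain ⟨x, hx⟩ := hC.exists
          exact (norm_nonneg _).trans hx
        rw [← ENNReal.ofReal_mul (by positivity), ← ENNReal.ofReal_mul (by positivity)]
        refine ENNReal.ofReal_le_ofReal ?_
        have e : ε ^ θ = q ^ θ * (ε / q) ^ θ := by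
          rw [← Real.mul_rpow (by positivity) ht0.le]; congr 1; field_simp
        have h1 : (ε / q) ^ θ * (ε / q) ^ (-s) ≤ 1 := by
          rw [← Real.rpow_add ht0]
          exact Real.rpow_le_one ht0.le hεq (by linarith)
        calc ε ^ θ * ((1 + I) * (ε / q) ^ (-s) * C)
            = ((ε / q) ^ θ * (ε / q) ^ (-s)) * ((1 + I) * q ^ θ * C) := by rw [e]; ring
          _ ≤ 1 * ((1 + I) * q ^ θ * C) := by gcongr
          _ = _ := one_mul _

end Weights

/-! ### The space with `a = 1`: equivalent norm and completeness -/

section UnweightedSpace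

variable {n : ℕ} {p q θ₁ θ₂ K : ℝ} {b : Weight n}

lemma le_grandNorm_oneWeight (θ : ℝ) (f : EuclideanSpace ℝ (Fin n) →ₘ[volume] ℂ) {ε : ℝ}
    (hε : ε ∈ Ioc (0 : ℝ) (p - 1)) :
    eLpNorm f (ENNReal.ofReal (p - ε)) volume ≤
      ENNReal.ofReal (ε ^ (-θ)) * grandNorm p θ (oneWeight n) f := by
  have h : ENNReal.ofReal (ε ^ θ) * eLpNorm f (ENNReal.ofReal (p - ε)) volume ≤
      grandNorm p θ (oneWeight n) f :=
    le_iSup₂_of_le (f := fun (ε : ℝ) (_ : ε ∈ Ioc (0 : ℝ) (p - 1)) => ENNReal.ofReal (ε ^ θ) *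
      eLpNorm f (ENNReal.ofReal (p - ε)) ((oneWeight n).powMeasure (ε / p))) ε hε (by simp)
  calc eLpNorm f (ENNReal.ofReal (p - ε)) volume
      = ENNReal.ofReal (ε ^ (-θ)) *
        (ENNReal.ofReal (ε ^ θ) * eLpNorm f (ENNReal.ofReal (p - ε)) volume) := by
        rw [← mul_assoc, ← ENNReal.ofReal_mul (Real.rpow_nonneg hε.1.le _),
          ← Real.rpow_add hε.1]
        simp
    _ ≤ _ := by gcongr

/-- At the endpoint `ε = p - 1` of the supremum the exponent is exactly 1. -/
lemma eLpNorm_one_le_grandNorm (hp : 1 < p) (θ : ℝ)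
    (f : EuclideanSpace ℝ (Fin n) →ₘ[volume] ℂ) :
    eLpNorm f 1 volume ≤ ENNReal.ofReal ((p - 1) ^ (-θ)) * grandNorm p θ (oneWeight n) f := by
  simpa using le_grandNorm_oneWeight (p := p) θ f (ε := p - 1) ⟨by linarith, le_rfl⟩

lemma integrable_of_grandNorm_lt_top (hp : 1 < p) {θ : ℝ}
    {f : EuclideanSpace ℝ (Fin n) →ₘ[volume] ℂ} (hf : grandNorm p θ (oneWeight n) f < ⊤) :
    Integrable f :=
  memLp_one_iff_integrable.1 ⟨f.aestronglyMeasurable,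
    (eLpNorm_one_le_grandNorm hp θ f).trans_lt (ENNReal.mul_lt_top ENNReal.ofReal_lt_top hf)⟩

lemma integral_norm_le_grandNorm (hp : 1 < p) {θ : ℝ}
    {f : EuclideanSpace ℝ (Fin n) →ₘ[volume] ℂ} (hf : grandNorm p θ (oneWeight n) f < ⊤) :
    ∫ x, ‖f x‖ ≤ (p - 1) ^ (-θ) * (grandNorm p θ (oneWeight n) f).toReal := by
  rw [integral_norm_eq_lintegral_enorm f.aestronglyMeasurable, ← eLpNorm_one_eq_lintegral_enorm]
  have := ENNReal.toReal_mono (ENNReal.mul_lt_top ENNReal.ofReal_lt_top hf).ne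
    (eLpNorm_one_le_grandNorm hp θ f)
  rwa [ENNReal.toReal_mul, ENNReal.toReal_ofReal (Real.rpow_nonneg (by linarith) _)] at this

/-- The sup norm of `f̂` is at most the L¹ norm of `f`, which the grand norm controls. -/
lemma grandNorm_fourierFun_le (hp : 1 < p) (hb : ContainsBounded q θ₂ b K)
    {f : EuclideanSpace ℝ (Fin n) →ₘ[volume] ℂ} (hf : grandNorm p θ₁ (oneWeight n) f < ⊤) :
    grandNorm q θ₂ b (fourierFun f) ≤
      ENNReal.ofReal (K * ((p - 1) ^ (-θ₁) * (grandNorm p θ₁ (oneWeight n) f).toReal)) :=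
  (hb.2 _ _ (ae_norm_fourierFun_le (integrable_of_grandNorm_lt_top hp hf))).trans
    (ENNReal.ofReal_le_ofReal (mul_le_mul_of_nonneg_left (integral_norm_le_grandNorm hp hf) hb.1))

lemma mem_grandFourierSubmodule_of_grandNorm (hp : 1 < p) (hb : ContainsBounded q θ₂ b K)
    {f : EuclideanSpace ℝ (Fin n) →ₘ[volume] ℂ} (hf : grandNorm p θ₁ (oneWeight n) f < ⊤) :
    f ∈ grandFourierSubmodule n p q θ₁ θ₂ (oneWeight n) b := by
  have hF := hasFourier_of_integrable (integrable_of_grandNorm_lt_top hp hf)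
  refine ⟨hf, _, hF, ?_⟩
  rw [← hF.fourierFun_eq]
  exact (grandNorm_fourierFun_le hp hb hf).trans_lt ENNReal.ofReal_lt_top

/-- If bounded functions lie in the target space, the norm of the space with `a = 1` is
controlled by its first summand. -/
lemma GrandFourierSpace.norm_le_grandNorm [hp : Fact (1 < p)] (hb : ContainsBounded q θ₂ b K)
    (f : GrandFourierSpace n p q θ₁ θ₂ (oneWeight n) b) :
    ‖f‖ ≤ (1 + K * (p - 1) ^ (-θ₁)) * (grandNorm p θ₁ (oneWeight n) f.1).toReal := by
  have hp1 : 0 ≤ p - 1 := by linarith [hp.out]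
  have h := ENNReal.toReal_mono ENNReal.ofReal_ne_top
    (grandNorm_fourierFun_le hp.out hb (f := f.1) f.2.1)
  rw [ENNReal.toReal_ofReal (mul_nonneg hb.1 (by positivity))] at h
  rw [GrandFourierSpace.norm_def]
  linarith

lemma GrandFourierSpace.grandNorm_le_norm [Fact (1 < p)] {a : Weight n}
    (f : GrandFourierSpace n p q θ₁ θ₂ a b) :
    grandNorm p θ₁ a f.1 ≤ ENNReal.ofReal ‖f‖ := by
  rw [← ENNReal.ofReal_toReal f.2.1.ne, GrandFourierSpace.norm_def]
  exact ENNReal.ofReal_le_ofReal (le_add_of_nonneg_right ENNReal.toReal_nonneg)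

/-- The grand Lebesgue norm is lower semicontinuous under convergence almost everywhere. -/
lemma grandNorm_le_of_tendsto_ae (p θ : ℝ) (w : Weight n)
    {f : ℕ → EuclideanSpace ℝ (Fin n) →ₘ[volume] ℂ} {g : EuclideanSpace ℝ (Fin n) →ₘ[volume] ℂ}
    (hfg : ∀ᵐ x, Tendsto (fun k => f k x) atTop (𝓝 (g x))) {C : ℝ≥0∞}
    (hC : ∀ᶠ k in atTop, grandNorm p θ w (f k) ≤ C) : grandNorm p θ w g ≤ C := by
  refine iSup₂_le fun ε hε => ?_
  have hpos : 0 < ε ^ θ := Real.rpow_pos_of_pos hε.1 _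
  have h0 : ENNReal.ofReal (ε ^ θ) ≠ 0 := by simpa using hpos
  rw [mul_comm, ← ENNReal.le_div_iff_mul_le (Or.inl h0) (Or.inl ENNReal.ofReal_ne_top)]
  refine (Lp.eLpNorm_lim_le_liminf_eLpNorm (fun k => aesm w _ (f k)) g
    ((powMeasure_ac w _).ae_le hfg)).trans ?_
  refine (liminf_le_liminf (hC.mono fun k hk => ?_)).trans_eq
    (liminf_const (C / ENNReal.ofReal (ε ^ θ)))
  rw [ENNReal.le_div_iff_mul_le (Or.inl h0) (Or.inl ENNReal.ofReal_ne_top), mul_comm]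
  exact (le_iSup₂_of_le (f := fun (ε : ℝ) (_ : ε ∈ Ioc (0 : ℝ) (p - 1)) => ENNReal.ofReal (ε ^ θ) *
      eLpNorm (f k) (ENNReal.ofReal (p - ε)) (w.powMeasure (ε / p))) ε hε le_rfl).trans hk

lemma completeSpace_of_containsBounded [hp : Fact (1 < p)] (hb : ContainsBounded q θ₂ b K) :
    CompleteSpace (GrandFourierSpace n p q θ₁ θ₂ (oneWeight n) b) := by
  have hp1 : 0 < p - 1 := by linarith [hp.out]
  set D : ℝ := (p - 1) ^ (-θ₁) with hD
  have hD0 : 0 < D := Real.rpow_pos_of_pos hp1 _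
  refine Metric.complete_of_convergent_controlled_sequences (fun k => (1 / 2 : ℝ) ^ k)
    (fun k => by positivity) fun u hu => ?_
  have hsub : ∀ k m, (u k - u m).1 = (u k).1 - (u m).1 := fun _ _ => rfl
  have hN : ∀ k m, grandNorm p θ₁ (oneWeight n) ((u k).1 - (u m).1) ≤
      ENNReal.ofReal (dist (u k) (u m)) := fun k m => by
    rw [dist_eq_norm, ← hsub]
    exact (u k - u m).grandNorm_le_norm
  have hlim : ∀ᵐ x, ∃ l : ℂ, Tendsto (fun k => (u k).1 x) atTop (𝓝 l) := by
    -- The geometric rate makes the L¹ increments summable, so the whole sequence converges almost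
    -- everywhere.
    refine Lp.ae_tendsto_of_cauchy_eLpNorm (p := 1) (fun k => (u k).1.aestronglyMeasurable) le_rfl
      (B := fun k => ENNReal.ofReal (D * (1 / 2 : ℝ) ^ k)) ?_ fun N k m hk hm => ?_
    · exact (summable_geometric_two.mul_left D).tsum_ofReal_ne_top
    · rw [← eLpNorm_congr_ae (AEEqFun.coeFn_sub (u k).1 (u m).1)]
      refine (eLpNorm_one_le_grandNorm hp.out θ₁ _).trans_lt ?_
      rw [ENNReal.ofReal_mul hD0.le]
      refine ENNReal.mul_lt_mul_right (by simpa using hD0) ENNReal.ofReal_ne_top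
        ((hN k m).trans_lt ?_)
      exact (ENNReal.ofReal_lt_ofReal_iff (by positivity)).2 (hu N k m hk hm)
  obtain ⟨g, hgm, hg⟩ := exists_stronglyMeasurable_limit_of_tendsto_ae
    (fun k => (u k).1.aestronglyMeasurable) hlim
  set G : EuclideanSpace ℝ (Fin n) →ₘ[volume] ℂ := AEEqFun.mk g hgm.aestronglyMeasurable
  have hconv : ∀ N, grandNorm p θ₁ (oneWeight n) ((u N).1 - G) ≤
      ENNReal.ofReal ((1 / 2 : ℝ) ^ N) := fun N => by
    refine grandNorm_le_of_tendsto_ae p θ₁ _ (f := fun k => (u N).1 - (u k).1) ?_ ?_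
    · have hall : ∀ᵐ x, ∀ k, ((u N).1 - (u k).1) x = (u N).1 x - (u k).1 x :=
        ae_all_iff.2 fun k => AEEqFun.coeFn_sub (u N).1 (u k).1
      filter_upwards [hall, hg, AEEqFun.coeFn_sub (u N).1 G,
        AEEqFun.coeFn_mk g hgm.aestronglyMeasurable] with x h1 h2 h3 h4
      have h5 : ((u N).1 - G) x = (u N).1 x - g x := h3.trans (congrArg ((u N).1 x - ·) h4)
      rw [h5]
      exact (tendsto_const_nhds.sub h2).congr fun k => (h1 k).symm
    · filter_upwards [eventually_ge_atTop N] with k hk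
      exact (hN N k).trans (ENNReal.ofReal_le_ofReal (hu N N k le_rfl hk).le)
  have hmem : ∀ N, (u N).1 - G ∈ grandFourierSubmodule n p q θ₁ θ₂ (oneWeight n) b := fun N =>
    mem_grandFourierSubmodule_of_grandNorm hp.out hb ((hconv N).trans_lt ENNReal.ofReal_lt_top)
  -- `G = u 0 - (u 0 - G)`, a difference of two elements of the space.
  have hG : G ∈ grandFourierSubmodule n p q θ₁ θ₂ (oneWeight n) b := by
    have := Submodule.sub_mem _ (u 0).2 (hmem 0)
    rwa [sub_sub_cancel] at this
  let G' : GrandFourierSpace n p q θ₁ θ₂ (oneWeight n) b := ⟨G, hG⟩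
  refine ⟨G', tendsto_iff_norm_sub_tendsto_zero.2 ?_⟩
  have hz : Tendsto (fun N : ℕ => (1 + K * D) * (1 / 2 : ℝ) ^ N) atTop (𝓝 0) := by
    simpa using (tendsto_pow_atTop_nhds_zero_of_lt_one (r := (1 / 2 : ℝ)) (by norm_num)
      (by norm_num)).const_mul (1 + K * D)
  refine squeeze_zero (fun N => norm_nonneg _) (fun N => ?_) hz
  refine ((u N - G').norm_le_grandNorm hb).trans ?_
  have hKD : 0 ≤ K * D := mul_nonneg hb.1 hD0.le
  refine mul_le_mul_of_nonneg_left ?_ (by positivity)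
  exact ENNReal.toReal_le_of_le_ofReal (by positivity) (hconv N)

end UnweightedSpace

/-! ### Blocks, their norms and the integrals over them -/

section Blocks

/-- Sums of `t ^ θ * exp (-t)` along geometric progressions are uniformly bounded. -/
lemma exists_sum_rpow_mul_exp_neg_le {θ : ℝ} (hθ : 0 < θ) :
    ∃ C : ℝ, 0 ≤ C ∧ ∀ t : ℝ, 0 < t → ∀ k : ℕ,
      ∑ j ∈ Finset.range k, (t * 2 ^ j) ^ θ * Real.exp (-(t * 2 ^ j)) ≤ C := by
  have hA : (1 : ℝ) < 2 ^ θ := Real.one_lt_rpow one_lt_two hθ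
  set A : ℝ := 2 ^ θ with hA_def
  set B : ℝ := (2 * θ) ^ θ with hB_def
  have hB : 0 < B := Real.rpow_pos_of_pos (by positivity) _
  have hexp : ∀ t : ℝ, 0 < t → t ^ θ ≤ B * Real.exp (t / 2) := fun t ht => by
    have h1 : t / (2 * θ) ≤ Real.exp (t / (2 * θ)) := by
      linarith [Real.add_one_le_exp (t / (2 * θ))]
    calc t ^ θ = (2 * θ * (t / (2 * θ))) ^ θ := by congr 1; field_simp
      _ = B * (t / (2 * θ)) ^ θ := Real.mul_rpow (by positivity) (by positivity)
      _ ≤ B * (Real.exp (t / (2 * θ))) ^ θ := by gcongr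
      _ = B * Real.exp (t / 2) := by rw [← Real.exp_mul]; congr 2; field_simp
  -- Chosen so that the factor `A - 1` in the telescoping difference below cancels.
  set C : ℝ := A * (1 + B) ^ 2 / (A - 1) with hC_def
  have hC : 0 ≤ C := div_nonneg (by positivity) (by linarith)
  -- Each term is dominated by an increment of a bounded monotone function between `t` and `2 * t`,
  -- so sums along the progression telescope.
  have hstep : ∀ t : ℝ, 0 < t → t ^ θ * Real.exp (-t) ≤
      C * ((1 + t ^ θ)⁻¹ - (1 + (t * 2) ^ θ)⁻¹) := fun t ht => by
    have hy : 0 < t ^ θ := Real.rpow_pos_of_pos ht _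
    have he : 1 ≤ Real.exp (t / 2) := Real.one_le_exp (by positivity)
    have h2 : (1 + t ^ θ) ^ 2 ≤ (1 + B) ^ 2 * Real.exp t := by
      have h3 : 1 + t ^ θ ≤ (1 + B) * Real.exp (t / 2) := by nlinarith [hexp t ht]
      calc (1 + t ^ θ) ^ 2 ≤ ((1 + B) * Real.exp (t / 2)) ^ 2 := by gcongr
        _ = (1 + B) ^ 2 * Real.exp t := by
          rw [mul_pow, ← Real.exp_nat_mul]; congr 2; push_cast; ring
    rw [Real.mul_rpow ht.le (by norm_num), ← hA_def]
    set y : ℝ := t ^ θ with hy_def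
    have e : C * ((1 + y)⁻¹ - (1 + y * A)⁻¹) =
        y * (A * (1 + B) ^ 2 / ((1 + y) * (1 + y * A))) := by
      have : A - 1 ≠ 0 := by linarith
      rw [hC_def]; field_simp; ring
    rw [e, Real.exp_neg]
    refine mul_le_mul_of_nonneg_left ?_ hy.le
    rw [inv_eq_one_div, div_le_div_iff₀ (Real.exp_pos _) (by positivity)]
    calc 1 * ((1 + y) * (1 + y * A)) ≤ A * (1 + y) ^ 2 := by nlinarith
      _ ≤ A * ((1 + B) ^ 2 * Real.exp t) := by gcongr
      _ = _ := by ring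
  refine ⟨C, hC, fun t ht k => ?_⟩
  calc ∑ j ∈ Finset.range k, (t * 2 ^ j) ^ θ * Real.exp (-(t * 2 ^ j))
      ≤ ∑ j ∈ Finset.range k,
          C * ((1 + (t * 2 ^ j) ^ θ)⁻¹ - (1 + (t * 2 ^ (j + 1)) ^ θ)⁻¹) := by
        refine Finset.sum_le_sum fun j _ => ?_
        rw [pow_succ, ← mul_assoc]
        exact hstep _ (by positivity)
    _ = C * ((1 + (t * 2 ^ 0) ^ θ)⁻¹ - (1 + (t * 2 ^ k) ^ θ)⁻¹) := by
        rw [← Finset.mul_sum, Finset.sum_range_sub' (fun j => (1 + (t * 2 ^ j) ^ θ)⁻¹)]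
    _ ≤ C * 1 := by
        refine mul_le_mul_of_nonneg_left ?_ hC
        have h1 : (1 + (t * 2 ^ 0) ^ θ)⁻¹ ≤ 1 :=
          inv_le_one_of_one_le₀ (le_add_of_nonneg_right (by positivity))
        have h2 : 0 ≤ (1 + (t * 2 ^ k) ^ θ)⁻¹ := by positivity
        linarith
    _ = C := mul_one C

/-- Since `(p - ε) * (p + ε) ≤ p ^ 2`, the total exponent `p * l - p ^ 2 * l / (p - ε)` is at most
`-(ε * l)`. -/
lemma rpow_mul_block_le {p θ ε l : ℝ} (hε : ε ∈ Ioc (0 : ℝ) (p - 1)) (hl : 0 < l) :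
    ε ^ θ * (l ^ θ * Real.exp (p * l) * Real.exp (-(p ^ 2 * l)) ^ (1 / (p - ε))) ≤
      (ε * l) ^ θ * Real.exp (-(ε * l)) := by
  have hr : 0 < p - ε := by linarith [hε.2]
  rw [Real.mul_rpow hε.1.le hl.le, ← Real.exp_mul, mul_assoc (l ^ θ), ← Real.exp_add, mul_assoc]
  have h0 : 0 ≤ ε ^ θ := Real.rpow_nonneg hε.1.le _
  gcongr
  have : p + ε ≤ p ^ 2 * (1 / (p - ε)) := by
    rw [mul_one_div, le_div_iff₀ hr]; nlinarith [sq_nonneg ε]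
  nlinarith

/-- For `ε = (p - 1) / l` and `r = p - ε` the powers of `l` cancel, and the remaining exponent `p ^
2 * l / r - p * l` equals `p * (p - 1) / r` with `r ≥ 1`. -/
lemma block_inv_mul_le {p θ l : ℝ} (hp : 1 < p) (hl : 1 ≤ l) :
    (l ^ θ * Real.exp (p * l) * Real.exp (-(p ^ 2 * l)))⁻¹ *
      (((p - 1) / l) ^ (-θ) * Real.exp (-(p ^ 2 * l)) ^ (1 - 1 / (p - (p - 1) / l))) ≤
      (p - 1) ^ (-θ) * Real.exp (p * (p - 1)) := by
  have hp1 : 0 < p - 1 := by linarith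
  have hl0 : 0 < l := by linarith
  have hεle : (p - 1) / l ≤ p - 1 := div_le_self hp1.le hl
  have hr : 1 ≤ p - (p - 1) / l := by linarith
  set r := p - (p - 1) / l with hr_def
  have hlθ : l ^ θ ≠ 0 := (Real.rpow_pos_of_pos hl0 _).ne'
  have hrl : r * l = p * l - (p - 1) := by rw [hr_def]; field_simp
  have e1 : ((p - 1) / l) ^ (-θ) = (p - 1) ^ (-θ) * l ^ θ := by
    rw [Real.div_rpow hp1.le hl0.le, Real.rpow_neg hl0.le, div_inv_eq_mul]
  have e2 : (l ^ θ * Real.exp (p * l) * Real.exp (-(p ^ 2 * l)))⁻¹ *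
      (((p - 1) / l) ^ (-θ) * Real.exp (-(p ^ 2 * l)) ^ (1 - 1 / r)) =
      (p - 1) ^ (-θ) * Real.exp (p ^ 2 * l / r - p * l) := by
    rw [e1, ← Real.exp_mul]
    have e3 : Real.exp (p ^ 2 * l / r - p * l) = (Real.exp (p * l))⁻¹ *
        (Real.exp (-(p ^ 2 * l)))⁻¹ * Real.exp (-(p ^ 2 * l) * (1 - 1 / r)) := by
      rw [← Real.exp_neg, ← Real.exp_neg, ← Real.exp_add, ← Real.exp_add]
      congr 1
      ring
    rw [e3]
    field_simp
  rw [e2]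
  gcongr
  rw [sub_le_iff_le_add, div_le_iff₀ (by linarith)]
  nlinarith [mul_nonneg (mul_nonneg (by linarith : (0 : ℝ) ≤ p) hp1.le) (sub_nonneg.2 hr)]

variable {n : ℕ}

/-- In positive dimension there are disjoint measurable sets of prescribed volumes at most `1`. -/
lemma exists_disjoint_volume_eq (hn : 1 ≤ n) {v : ℕ → ℝ} (hv : ∀ j, v j ≤ 1) :
    ∃ E : ℕ → Set (EuclideanSpace ℝ (Fin n)), (∀ j, MeasurableSet (E j)) ∧
      Pairwise (Function.onFun Disjoint E) ∧ ∀ j, volume (E j) = ENNReal.ofReal (v j) := by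
  let i₀ : Fin n := ⟨0, hn⟩
  -- Boxes `[j, j + v j) × [0, 1)^(n - 1)`, disjoint in the first coordinate because `v j ≤ 1`.
  let I : ℕ → Fin n → Set ℝ := fun j i => if i = i₀ then Ico (j : ℝ) (j + v j) else Ico 0 1
  have hI : ∀ j i, MeasurableSet (I j i) := fun j i => by
    dsimp only [I]; split_ifs <;> exact measurableSet_Ico
  have hm : ∀ j, MeasurableSet (univ.pi (I j)) := fun j =>
    MeasurableSet.univ_pi (hI j)
  refine ⟨fun j => WithLp.ofLp ⁻¹' univ.pi (I j), fun j =>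
    (PiLp.volume_preserving_ofLp (Fin n)).measurable (hm j), fun j k hjk => ?_, fun j => ?_⟩
  · refine Disjoint.preimage _ ?_
    rw [disjoint_univ_pi]
    refine ⟨i₀, ?_⟩
    simp only [I, if_true]
    rw [Set.Ico_disjoint_Ico]
    rcases lt_or_gt_of_ne hjk with h | h
    · have h' : (j : ℝ) + 1 ≤ k := by exact_mod_cast h
      exact (min_le_left _ _).trans (by linarith [hv j, le_max_right (j : ℝ) k])
    · have h' : (k : ℝ) + 1 ≤ j := by exact_mod_cast h
      exact (min_le_right _ _).trans (by linarith [hv k, le_max_left (j : ℝ) k])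
  · rw [(PiLp.volume_preserving_ofLp (Fin n)).measure_preimage (hm j).nullMeasurableSet,
      volume_pi_pi, Finset.prod_eq_single i₀]
    · simp [I]
    · intro i _ hi
      simp [I, hi]
    · simp

/-- The class of the function equal to the constant `c` on `E` and to `0` elsewhere. -/
noncomputable def blockFun {E : Set (EuclideanSpace ℝ (Fin n))} (hE : MeasurableSet E) (c : ℂ) :
    EuclideanSpace ℝ (Fin n) →ₘ[volume] ℂ :=
  AEEqFun.mk (E.indicator fun _ => c) (aestronglyMeasurable_const.indicator hE)

lemma coeFn_blockFun {E : Set (EuclideanSpace ℝ (Fin n))} (hE : MeasurableSet E) (c : ℂ) :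
    blockFun hE c =ᵐ[volume] E.indicator fun _ => c :=
  AEEqFun.coeFn_mk _ _

lemma eLpNorm_blockFun {E : Set (EuclideanSpace ℝ (Fin n))} (hE : MeasurableSet E) {c v r : ℝ}
    (hc : 0 ≤ c) (hv : 0 ≤ v) (hEv : volume E = ENNReal.ofReal v) (hr : 0 < r) :
    eLpNorm (blockFun hE (c : ℂ)) (ENNReal.ofReal r) volume =
      ENNReal.ofReal (c * v ^ (1 / r)) := by
  rw [eLpNorm_congr_ae (coeFn_blockFun hE _), eLpNorm_indicator_const hE (by simpa using hr)
    ENNReal.ofReal_ne_top, hEv, ENNReal.toReal_ofReal hr.le,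
    ENNReal.ofReal_rpow_of_nonneg hv (by positivity), ENNReal.ofReal_mul hc,
    ← ofReal_norm]
  simp [abs_of_nonneg hc]

lemma eLpNorm_sum_le_sum {ι : Type*} {r : ℝ≥0∞} (hr : 1 ≤ r) (s : Finset ι)
    (f : ι → EuclideanSpace ℝ (Fin n) →ₘ[volume] ℂ) :
    eLpNorm (∑ i ∈ s, f i : EuclideanSpace ℝ (Fin n) →ₘ[volume] ℂ) r volume ≤
      ∑ i ∈ s, eLpNorm (f i) r volume := by
  refine Finset.le_sum_of_subadditive
    (fun g : EuclideanSpace ℝ (Fin n) →ₘ[volume] ℂ => eLpNorm g r volume) ?_ ?_ s f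
  · rw [eLpNorm_congr_ae AEEqFun.coeFn_zero]
    exact eLpNorm_zero.le
  · intro g h
    rw [eLpNorm_congr_ae (AEEqFun.coeFn_add g h)]
    exact eLpNorm_add_le g.aestronglyMeasurable h.aestronglyMeasurable hr

/-- Hölder's inequality on `E` with exponent `p - ε`; keeping `ε` free allows it to be tuned to each
block. -/
lemma norm_setIntegral_le_grandNorm {p θ ε v N : ℝ} (hε : ε ∈ Ioc (0 : ℝ) (p - 1)) (hv : 0 < v)
    {E : Set (EuclideanSpace ℝ (Fin n))} (hEv : volume E = ENNReal.ofReal v) (hN : 0 ≤ N)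
    {f : EuclideanSpace ℝ (Fin n) →ₘ[volume] ℂ}
    (hf : grandNorm p θ (oneWeight n) f ≤ ENNReal.ofReal N) :
    ‖∫ x in E, f x‖ ≤ ε ^ (-θ) * v ^ (1 - 1 / (p - ε)) * N := by
  have hr : 1 ≤ p - ε := by linarith [hε.2]
  have hε0 : 0 ≤ ε ^ (-θ) := Real.rpow_nonneg hε.1.le _
  have h : ‖∫ x in E, f x‖ₑ ≤ ENNReal.ofReal (ε ^ (-θ) * v ^ (1 - 1 / (p - ε)) * N) := by
    calc ‖∫ x in E, f x‖ₑ ≤ ∫⁻ x in E, ‖f x‖ₑ := enorm_integral_le_lintegral_enorm _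
      _ = eLpNorm f 1 (volume.restrict E) := eLpNorm_one_eq_lintegral_enorm.symm
      _ ≤ eLpNorm f (ENNReal.ofReal (p - ε)) (volume.restrict E) *
          volume.restrict E univ ^
            (1 / (1 : ℝ≥0∞).toReal - 1 / (ENNReal.ofReal (p - ε)).toReal) :=
          eLpNorm_le_eLpNorm_mul_rpow_measure_univ (ENNReal.one_le_ofReal.2 hr)
            f.aestronglyMeasurable.restrict
      _ = eLpNorm f (ENNReal.ofReal (p - ε)) (volume.restrict E) *
          ENNReal.ofReal (v ^ (1 - 1 / (p - ε))) := by
          rw [Measure.restrict_apply_univ, hEv, ENNReal.toReal_ofReal (by linarith),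
            ENNReal.toReal_one, div_one, ENNReal.ofReal_rpow_of_pos hv]
      _ ≤ (ENNReal.ofReal (ε ^ (-θ)) * ENNReal.ofReal N) *
          ENNReal.ofReal (v ^ (1 - 1 / (p - ε))) := by
          gcongr
          exact (eLpNorm_mono_measure _ Measure.restrict_le_self).trans
            ((le_grandNorm_oneWeight θ f hε).trans (by gcongr))
      _ = _ := by
          rw [← ENNReal.ofReal_mul hε0, ← ENNReal.ofReal_mul (by positivity)]
          congr 1
          ring
  rw [← ofReal_norm] at h
  exact (ENNReal.ofReal_le_ofReal_iff (by positivity)).1 h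

end Blocks

/-! ### Failure of reflexivity -/

section NotReflexive

variable {n : ℕ} {p q θ₁ θ₂ K : ℝ} {b : Weight n}

lemma GrandFourierSpace.exists_setIntegral_dual [hp : Fact (1 < p)] {ε v : ℝ}
    (hε : ε ∈ Ioc (0 : ℝ) (p - 1)) (hv : 0 < v) {E : Set (EuclideanSpace ℝ (Fin n))}
    (hEv : volume E = ENNReal.ofReal v) :
    ∃ T : StrongDual ℂ (GrandFourierSpace n p q θ₁ θ₂ (oneWeight n) b),
      ‖T‖ ≤ ε ^ (-θ₁) * v ^ (1 - 1 / (p - ε)) ∧ ∀ f, T f = ∫ x in E, f.1 x := by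
  have hint : ∀ f : GrandFourierSpace n p q θ₁ θ₂ (oneWeight n) b,
      IntegrableOn f.1 E := fun f =>
    (integrable_of_grandNorm_lt_top hp.out f.2.1).integrableOn
  let T : GrandFourierSpace n p q θ₁ θ₂ (oneWeight n) b →ₗ[ℂ] ℂ :=
    { toFun := fun f => ∫ x in E, f.1 x
      map_add' := fun f g => by
        rw [← integral_add (hint f) (hint g)]
        exact integral_congr_ae (ae_restrict_of_ae (AEEqFun.coeFn_add f.1 g.1))
      map_smul' := fun c f => by
        rw [RingHom.id_apply, ← integral_smul]
        exact integral_congr_ae (ae_restrict_of_ae (AEEqFun.coeFn_smul c f.1)) }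
  have hM : 0 ≤ ε ^ (-θ₁) * v ^ (1 - 1 / (p - ε)) :=
    mul_nonneg (Real.rpow_nonneg hε.1.le _) (Real.rpow_nonneg hv.le _)
  exact ⟨T.mkContinuous _ fun f => norm_setIntegral_le_grandNorm hε hv hEv (norm_nonneg f)
    f.grandNorm_le_norm, T.mkContinuous_norm_le hM _, fun f => rfl⟩

lemma setIntegral_blockFun {E F : Set (EuclideanSpace ℝ (Fin n))} (hE : MeasurableSet E)
    (c : ℂ) : ∫ x in F, blockFun hE c x = volume.real (E ∩ F) * c := by
  rw [integral_congr_ae (ae_restrict_of_ae (coeFn_blockFun hE c)), integral_indicator hE,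
    Measure.restrict_restrict hE, setIntegral_const, Complex.real_smul]

theorem not_isReflexive_of_containsBounded [hp : Fact (1 < p)] (hn : 1 ≤ n) (hθ₁ : 0 < θ₁)
    (hb : ContainsBounded q θ₂ b K) :
    ¬ IsReflexive (GrandFourierSpace n p q θ₁ θ₂ (oneWeight n) b) := by
  have hp1 : 0 < p - 1 := by linarith [hp.out]
  let v : ℕ → ℝ := fun j => Real.exp (-(p ^ 2 * 2 ^ j))
  let c : ℕ → ℝ := fun j => (2 ^ j : ℝ) ^ θ₁ * Real.exp (p * 2 ^ j)
  have hv : ∀ j, 0 < v j := fun j => Real.exp_pos _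
  have hc : ∀ j, 0 < c j := fun j => by positivity
  obtain ⟨E, hEm, hEd, hEv⟩ := exists_disjoint_volume_eq hn (v := v) fun j =>
    Real.exp_le_one_iff.2 (neg_nonpos.2 (by positivity))
  obtain ⟨C, hC0, hC⟩ := exists_sum_rpow_mul_exp_neg_le hθ₁
  let F : ℕ → EuclideanSpace ℝ (Fin n) →ₘ[volume] ℂ := fun k =>
    ∑ j ∈ Finset.range k, blockFun (hEm j) (c j : ℂ)
  have hF : ∀ k, grandNorm p θ₁ (oneWeight n) (F k) ≤ ENNReal.ofReal C := fun k => by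
    refine iSup₂_le fun ε hε => ?_
    have hr : 1 ≤ p - ε := by linarith [hε.2]
    rw [oneWeight_powMeasure]
    calc ENNReal.ofReal (ε ^ θ₁) * eLpNorm (F k) (ENNReal.ofReal (p - ε)) volume
        ≤ ENNReal.ofReal (ε ^ θ₁) * ∑ j ∈ Finset.range k,
            eLpNorm (blockFun (hEm j) (c j : ℂ)) (ENNReal.ofReal (p - ε)) volume := by
          gcongr
          exact eLpNorm_sum_le_sum (ENNReal.one_le_ofReal.2 hr) _ _
      _ = ENNReal.ofReal (∑ j ∈ Finset.range k, ε ^ θ₁ * (c j * v j ^ (1 / (p - ε)))) := by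
          rw [Finset.mul_sum, ENNReal.ofReal_sum_of_nonneg fun j _ =>
            mul_nonneg (Real.rpow_nonneg hε.1.le _)
              (mul_nonneg (hc j).le (Real.rpow_nonneg (hv j).le _))]
          refine Finset.sum_congr rfl fun j _ => ?_
          rw [eLpNorm_blockFun (hEm j) (hc j).le (hv j).le (hEv j) (by linarith),
            ENNReal.ofReal_mul (Real.rpow_nonneg hε.1.le _)]
      _ ≤ ENNReal.ofReal C := by
          refine ENNReal.ofReal_le_ofReal ((Finset.sum_le_sum fun j _ => ?_).trans (hC ε hε.1 k))
          exact rpow_mul_block_le hε (by positivity)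
  have hmem : ∀ k, F k ∈ grandFourierSubmodule n p q θ₁ θ₂ (oneWeight n) b := fun k =>
    mem_grandFourierSubmodule_of_grandNorm hp.out hb ((hF k).trans_lt ENNReal.ofReal_lt_top)
  -- The shift to `k + 1` includes block `k` in `S k`, as the case `j = k` of the criterion demands.
  let S : ℕ → GrandFourierSpace n p q θ₁ θ₂ (oneWeight n) b := fun k => ⟨F (k + 1), hmem (k + 1)⟩
  let B : ℕ → GrandFourierSpace n p q θ₁ θ₂ (oneWeight n) b := fun j =>
    ⟨blockFun (hEm j) (c j : ℂ), by
      -- A block is a difference of consecutive partial sums, so its membership needs no new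
      -- estimate.
      have := Submodule.sub_mem _ (hmem (j + 1)) (hmem j)
      rwa [Finset.sum_range_succ_sub_sum] at this⟩
  -- The exponent parameter at which block `j` is essentially largest.
  have hε : ∀ j : ℕ, (p - 1) / 2 ^ j ∈ Ioc (0 : ℝ) (p - 1) := fun j =>
    ⟨by positivity, div_le_self hp1.le (one_le_pow₀ one_le_two)⟩
  choose T hTn hT using fun j => GrandFourierSpace.exists_setIntegral_dual (q := q) (θ₁ := θ₁)
    (θ₂ := θ₂) (b := b) (hε j) (hv j) (hEv j)
  have hreal : ∀ j, volume.real (E j) = v j := fun j => by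
    rw [Measure.real, hEv, ENNReal.toReal_ofReal (hv j).le]
  have hblock : ∀ i j, ∫ x in E j, blockFun (hEm i) (c i : ℂ) x =
      if i = j then ((c j * v j : ℝ) : ℂ) else 0 := fun i j => by
    rw [setIntegral_blockFun]
    split_ifs with h
    · rw [h, inter_self, hreal, mul_comm, ← Complex.ofReal_mul]
    · rw [(hEd h).inter_eq]
      simp
  have hTS : ∀ j k, T j (S k) = if j ∈ Finset.range (k + 1) then ((c j * v j : ℝ) : ℂ) else 0 :=
    fun j k => by
      have hS : S k = ∑ i ∈ Finset.range (k + 1), B i := by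
        refine Subtype.ext (Eq.symm ?_)
        exact map_sum (grandFourierSubmodule n p q θ₁ θ₂ (oneWeight n) b).subtype B
          (Finset.range (k + 1))
      rw [hS, map_sum]
      simp_rw [hT]
      exact (Finset.sum_congr rfl fun i _ => hblock i j).trans (Finset.sum_ite_eq' _ _ _)
  have hcv : ∀ j, ((c j * v j : ℝ) : ℂ) ≠ 0 := fun j =>
    Complex.ofReal_ne_zero.2 (mul_pos (hc j) (hv j)).ne'
  refine not_isReflexive_of_biorthogonal S (fun j => ((c j * v j : ℝ) : ℂ)⁻¹ • T j)
    (C := (1 + K * (p - 1) ^ (-θ₁)) * C) (M := (p - 1) ^ (-θ₁) * Real.exp (p * (p - 1)))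
    (fun k => ?_) (fun j => ?_) (fun j k hjk => ?_) (fun j k hjk => ?_)
  · have hK : 0 ≤ K * (p - 1) ^ (-θ₁) := mul_nonneg hb.1 (Real.rpow_nonneg hp1.le _)
    exact ((S k).norm_le_grandNorm hb).trans (mul_le_mul_of_nonneg_left
      (ENNReal.toReal_le_of_le_ofReal hC0 (hF (k + 1))) (by positivity))
  · rw [norm_smul, norm_inv, Complex.norm_real, Real.norm_of_nonneg (mul_pos (hc j) (hv j)).le]
    exact (mul_le_mul_of_nonneg_left (hTn j) (inv_nonneg.2 (mul_pos (hc j) (hv j)).le)).trans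
      (block_inv_mul_le hp.out (one_le_pow₀ one_le_two))
  · change _ * T j (S k) = 1
    rw [hTS, if_pos (Finset.mem_range.2 (by omega)), inv_mul_cancel₀ (hcv j)]
  · change _ * T j (S k) = 0
    rw [hTS, if_neg (by simpa using hjk), mul_zero]

end NotReflexive

end GrandFourier

theorem corollary4 (n : ℕ) (hn : 1 ≤ n) (p q θ₁ θ₂ : ℝ) [hp : Fact (1 < p)] (hq : 1 < q)
    (hθ₁ : 0 < θ₁) (hθ₂ : 0 < θ₂) :
    ∃ a b : GrandFourier.Weight n,
      CompleteSpace (GrandFourier.GrandFourierSpace n p q θ₁ θ₂ a b) ∧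
      ¬ GrandFourier.IsReflexive (GrandFourier.GrandFourierSpace n p q θ₁ θ₂ a b) := by
  obtain ⟨b, K, hb⟩ := GrandFourier.exists_containsBounded n hq hθ₂
  exact ⟨GrandFourier.oneWeight n, b, GrandFourier.completeSpace_of_containsBounded hb,
    GrandFourier.not_isReflexive_of_containsBounded hn hθ₁ hb⟩
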